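/- Let $n,c\ge 0$ be integers and let $\Psi=F_n/\gamma_{c+1}(F_n)$ be the free nilpotent group of class $c$ on $n$ generators, where $F_n$ is the free group on $n$ generators, $\gamma_1(F_n)=F_n$ and $\gamma_{i+1}(F_n)=[\gamma_i(F_n),F_n]$. For a group $G$ let $\hat G$ be its profinite completion. Let $IA(\Psi)$ be the group of automorphisms of $\Psi$ that act trivially on $\Psi/[\Psi,\Psi]$, and let $IA(\hat\Psi)$ be the group of continuous automorphisms of $\hat\Psi$ that act trivially on $\hat\Psi/\overline{[\hat\Psi,\hat\Psi]}$, with the compact-open topology. Then the homomorphism $IA(\Psi)\to Aut(\hat\Psi)$ that sends an automorphism of $\Psi$ to the automorphism it induces on $\hat\Psi$ extends to a unique continuous homomorphism $\widehat{IA(\Psi)}\to IA(\hat\Psi)$, and this map is an isomorphism of topological groups. -/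

import Mathlib

open CategoryTheory

noncomputable section

namespace NilpotentCSP

universe u

/-- The free nilpotent group of class `c` on `n` generators, `F_n / γ_{c+1}(F_n)`. The series
`lowerCentralSeries` starts with the whole group at index `0`, so `c = 0` is the trivial group
and `c = 1` is `ℤ^n`. -/
abbrev FreeNilpotent (n c : ℕ) : Type :=
  FreeGroup (Fin n) ⧸ (⊤ : Subgroup (FreeGroup (Fin n))).lowerCentralSeries c

/-- The profinite completion of an abstract group. -/
abbrev Completion (G : Type u) [Group G] : ProfiniteGrp.{u} :=
  ProfiniteGrp.ProfiniteCompletion.completion (GrpCat.of G)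

/-- The canonical homomorphism from a group to its profinite completion. -/
def eta (G : Type u) [Group G] : G →* Completion G :=
  (ProfiniteGrp.ProfiniteCompletion.eta (GrpCat.of G)).hom

section ContinuousAutomorphisms

variable {P : Type u} [Group P] [TopologicalSpace P]

/-- The group of continuous automorphisms of a topological group, under composition. -/
instance contAutGroup : Group (P ≃ₜ* P) where
  mul a b := b.trans a
  one := ContinuousMulEquiv.refl P
  inv a := a.symm
  mul_assoc _ _ _ := rfl
  one_mul _ := rfl
  mul_one _ := rfl
  inv_mul_cancel a := ContinuousMulEquiv.ext fun x => a.symm_apply_apply x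

/-- The compact-open topology on the group of continuous automorphisms. -/
instance contAutTopology : TopologicalSpace (P ≃ₜ* P) :=
  TopologicalSpace.induced (fun a => (⟨a, a.continuous_toFun⟩ : C(P, P))) inferInstance

end ContinuousAutomorphisms

/-- `IA(G)`: the automorphisms of `G` that act trivially on the abelianization `G / [G, G]`. -/
def IA (G : Type u) [Group G] : Subgroup (MulAut G) where
  carrier := {a | ∀ g, Abelianization.of (a g) = Abelianization.of g}
  one_mem' _ := rfl
  mul_mem' {a b} ha hb g := (ha (b g)).trans (hb g)
  inv_mem' {a} ha g := by
    have h := ha (a⁻¹ g)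
    rw [MulAut.apply_inv_self] at h
    exact h.symm

/-- `IA(P)` for a topological group `P`: the continuous automorphisms of `P` that act trivially
on the quotient of `P` by the closure of `[P, P]`. It carries the subspace topology. -/
def contIA (P : Type u) [Group P] [TopologicalSpace P] [IsTopologicalGroup P] :
    Subgroup (P ≃ₜ* P) where
  carrier := {a | ∀ g, (QuotientGroup.mk (a g) : TopologicalAbelianization P) = QuotientGroup.mk g}
  one_mem' _ := rfl
  mul_mem' {a b} ha hb g := (ha (b g)).trans (hb g)
  inv_mem' {a} ha g := by
    have h := ha (a.symm g)
    rw [a.apply_symm_apply] at h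
    exact h.symm

/-- The continuous homomorphism of profinite completions induced by a homomorphism. -/
def completionMap {G H : Type u} [Group G] [Group H] (f : G →* H) :
    Completion G →ₜ* Completion H :=
  (ProfiniteGrp.profiniteCompletion.map (GrpCat.ofHom f)).hom

theorem completionMap_leftInverse {G H : Type u} [Group G] [Group H] (f : G →* H) (g : H →* G)
    (h : g.comp f = MonoidHom.id G) (x : Completion G) :
    completionMap g (completionMap f x) = x := by
  have h1 : ProfiniteGrp.profiniteCompletion.map (GrpCat.ofHom f) ≫
      ProfiniteGrp.profiniteCompletion.map (GrpCat.ofHom g) = 𝟙 _ := by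
    rw [← Functor.map_comp, ← GrpCat.ofHom_comp, h]
    exact ProfiniteGrp.profiniteCompletion.map_id _
  have h2 := DFunLike.congr_fun (congrArg ProfiniteGrp.Hom.hom h1) x
  rw [ProfiniteGrp.hom_comp] at h2
  exact h2

/-- The continuous automorphism of the profinite completion induced by an automorphism. -/
def completionAut {G : Type u} [Group G] (a : MulAut G) : Completion G ≃ₜ* Completion G where
  toFun := completionMap a.toMonoidHom
  invFun := completionMap a.symm.toMonoidHom
  left_inv := completionMap_leftInverse _ _ (by ext x; exact a.symm_apply_apply x)
  right_inv := completionMap_leftInverse _ _ (by ext x; exact a.apply_symm_apply x)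
  map_mul' := map_mul _
  continuous_toFun := (completionMap a.toMonoidHom).continuous_toFun
  continuous_invFun := (completionMap a.symm.toMonoidHom).continuous_toFun

/-- A continuous homomorphism from the profinite completion of `IA(G)` to `IA` of the profinite
completion of `G` is the congruence map if it extends the natural map that sends an automorphism
of `G` to the automorphism it induces on the profinite completion of `G`. -/
def IsCongruenceMap {G : Type u} [Group G]
    (φ : Completion (IA G) →ₜ* contIA (Completion G)) : Prop :=
  ∀ a : IA G, (φ (eta (IA G) a) : Completion G ≃ₜ* Completion G) = completionAut (a : MulAut G)

end NilpotentCSP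

end

/-! Let Ψ be free nilpotent. Since Ψ̂ is topologically finitely generated, IA(Ψ̂) is profinite, so
IA(Ψ) → IA(Ψ̂) extends to the completion of IA(Ψ), uniquely by density. An element a of IA(Ψ̂) is
determined by its displacements y_i⁻¹ a(y_i) on the images y_i of the free generators, and these lie
in the closure of [Ψ, Ψ].

Surjectivity: an endomorphism of a nilpotent group that is trivial on the abelianization is
bijective, so every tuple in [Ψ, Ψ] is the displacement of an element of IA(Ψ)
(`FreeNilpotent.exists_mem_IA`). Such tuples are dense among the possible ones, and the image of a
compact group is closed.

Injectivity is a congruence subgroup property (`exists_congruenceSubgroup_le`): each finite index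
subgroup H of IA(Ψ) contains the kernel of the action on some finite quotient Ψ/N. Induct on the
class. Let A be the last term of the lower central series and m the index of the normal core of H.
Automorphisms trivial modulo A multiply the generators by elements of A; if these are m-th powers in
A, the automorphism is an m-th power, hence in H. So N must satisfy N ∩ A ⊆ A^m, which finitely
generated nilpotent groups allow (`Group.IsNilpotent.exists_finiteIndex_inf_subset_pow`). -/

/-! ### Finitely generated nilpotent groups and their finite quotients. -/

section FinitelyGeneratedNilpotent

open Subgroup

open scoped commutatorElement IsMulCommutative

/-- A subgroup is finitely generated if its image and its intersection with the kernel of some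
homomorphism are. -/
theorem Subgroup.fg_of_fg_map_of_fg_inf_ker {G Q : Type*} [Group G] [Group Q] (f : G →* Q)
    (H : Subgroup G) (hmap : (H.map f).FG) (hker : (H ⊓ f.ker).FG) : H.FG := by
  classical
  obtain ⟨T, hT⟩ := hmap
  have hTH : (T : Set Q) ⊆ f '' H := by
    intro t ht
    have : t ∈ H.map f := hT ▸ Subgroup.subset_closure ht
    exact this
  obtain ⟨S, hS, rfl⟩ := Finset.subset_set_image_iff.mp hTH
  have hSH : closure (S : Set G) ≤ H := (closure_le H).mpr hS
  have : H = closure (S : Set G) ⊔ (H ⊓ f.ker) := by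
    apply le_antisymm
    · intro h hh
      have h1 : f h ∈ (closure (S : Set G)).map f := by
        rw [MonoidHom.map_closure, ← Finset.coe_image, hT]
        exact mem_map_of_mem f hh
      obtain ⟨s, hs, hsf⟩ := h1
      have h2 : s⁻¹ * h ∈ H ⊓ f.ker :=
        ⟨H.mul_mem (H.inv_mem (hSH hs)) hh, by simp [hsf]⟩
      rw [← mul_inv_cancel_left s h]
      exact mul_mem (mem_sup_left hs) (mem_sup_right h2)
    · exact sup_le hSH inf_le_left
  rw [this]
  exact Subgroup.FG.sup ⟨S, rfl⟩ hker

/-- A finitely generated abelian group is a Noetherian ℤ-module. -/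
theorem Subgroup.FG.of_le_of_isMulCommutative {G : Type*} [Group G] {A B : Subgroup G}
    [IsMulCommutative A] (hA : A.FG) (hBA : B ≤ A) : B.FG := by
  have h1 : Group.FG A := (Group.fg_iff_subgroup_fg A).mpr hA
  have h2 : AddGroup.FG (Additive A) := GroupFG.iff_add_fg.mp h1
  have h3 : Module.Finite ℤ (Additive A) := Module.Finite.iff_addGroup_fg.mpr h2
  have h4 : IsNoetherian ℤ (Additive A) := inferInstance
  have h5 : (B.subgroupOf A).FG := by
    rw [Subgroup.fg_iff_add_fg]
    have := IsNoetherian.noetherian (AddSubgroup.toIntSubmodule (B.subgroupOf A).toAddSubgroup)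
    rwa [Submodule.fg_iff_addSubgroup_fg] at this
  obtain ⟨S, hS⟩ := h5
  classical
  refine ⟨S.image A.subtype, ?_⟩
  rw [Finset.coe_image, ← MonoidHom.map_closure, hS, subgroupOf_map_subtype, inf_eq_left.mpr hBA]

theorem commutatorElement_mul_right_of_mem_center {G : Type*} [Group G] {a c : G} (b : G)
    (h : ⁅a, c⁆ ∈ center G) : ⁅a, b * c⁆ = ⁅a, b⁆ * ⁅a, c⁆ := by
  rw [commutatorElement_mul_right_eq_mul_conj, mul_assoc _ b, mem_center_iff.mp h b, ← mul_assoc,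
    mul_inv_cancel_right]

theorem commutatorElement_mul_left_of_mem_center {G : Type*} [Group G] (a : G) {b c : G}
    (h : ⁅b, c⁆ ∈ center G) : ⁅a * b, c⁆ = ⁅b, c⁆ * ⁅a, c⁆ := by
  rw [commutatorElement_mul_left_eq_conj_mul, mem_center_iff.mp h a]
  simp

/-- If `⁅B, G⁆` is central, it is generated by the commutators of generators of `B` modulo the
center with generators of `G`. -/
theorem Subgroup.commutator_top_fg_of_le_center {G : Type*} [Group G] [hG : Group.FG G]
    {B : Subgroup G} (hB : ⁅B, (⊤ : Subgroup G)⁆ ≤ center G) {S : Set G} (hS : S.Finite)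
    (hSB : S ⊆ B) (hBS : B ≤ closure S ⊔ center G) : ⁅B, (⊤ : Subgroup G)⁆.FG := by
  obtain ⟨X, hX, hXfin⟩ := Group.fg_iff.mp hG
  have hc : ∀ b ∈ B, ∀ g, ⁅b, g⁆ ∈ center G := fun b hb g =>
    hB (commutator_mem_commutator hb (mem_top g))
  let L : Subgroup G := closure (Set.image2 (fun s x => ⁅s, x⁆) S X)
  have hL1 : ∀ s ∈ S, ∀ g, ⁅s, g⁆ ∈ L := by
    intro s hs g
    have hg : g ∈ closure X := hX ▸ mem_top g
    induction hg using closure_induction with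
    | mem x hx => exact subset_closure ⟨s, hs, x, hx, rfl⟩
    | one => simp
    | mul x y _ _ hx hy =>
      rw [commutatorElement_mul_right_of_mem_center _ (hc s (hSB hs) y)]
      exact mul_mem hx hy
    | inv x _ hx =>
      have := commutatorElement_mul_right_of_mem_center x⁻¹ (hc s (hSB hs) x)
      rw [inv_mul_cancel, commutatorElement_one_right] at this
      rw [eq_inv_of_mul_eq_one_left this.symm]
      exact inv_mem hx
  have hSc : closure S ≤ B := (closure_le B).mpr hSB
  have hL2 : ∀ b ∈ closure S, ∀ g, ⁅b, g⁆ ∈ L := by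
    intro b hb g
    induction hb using closure_induction with
    | mem x hx => exact hL1 x hx g
    | one => simp
    | mul x y _ hy0 hx hy =>
      rw [commutatorElement_mul_left_of_mem_center _ (hc y (hSc hy0) g)]
      exact mul_mem hy hx
    | inv x hx0 hx =>
      have := commutatorElement_mul_left_of_mem_center x⁻¹ (hc x (hSc hx0) g)
      rw [inv_mul_cancel, commutatorElement_one_left] at this
      rw [eq_inv_of_mul_eq_one_right this.symm]
      exact inv_mem hx
  have hL : ⁅B, (⊤ : Subgroup G)⁆ = L := by
    apply le_antisymm
    · rw [commutator_le]
      intro b hb g _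
      obtain ⟨s, hs, z, hz, rfl⟩ := mem_sup_of_normal_right.mp (hBS hb)
      have hzg : ⁅z, g⁆ = 1 :=
        commutatorElement_eq_one_iff_mul_comm.mpr (mem_center_iff.mp hz g).symm
      rw [commutatorElement_mul_left_of_mem_center _ (by rw [hzg]; exact one_mem _), hzg, one_mul]
      exact hL2 s hs g
    · rw [closure_le]
      rintro _ ⟨s, hs, x, _, rfl⟩
      exact commutator_mem_commutator (hSB hs) (mem_top x)
  rw [hL, Subgroup.fg_iff]
  exact ⟨_, rfl, hS.image2 _ hXfin⟩

theorem Subgroup.top_lowerCentralSeries_quotient {G : Type*} [Group G] (A : Subgroup G) [A.Normal]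
    (i : ℕ) : (⊤ : Subgroup (G ⧸ A)).lowerCentralSeries i =
      ((⊤ : Subgroup G).lowerCentralSeries i).map (QuotientGroup.mk' A) := by
  rw [map_lowerCentralSeries, map_top_of_surjective _ (QuotientGroup.mk'_surjective A)]

theorem Subgroup.top_lowerCentralSeries_quotient_eq_bot {G : Type*} [Group G] (A : Subgroup G)
    [A.Normal] (i : ℕ) (h : (⊤ : Subgroup G).lowerCentralSeries i ≤ A) :
    (⊤ : Subgroup (G ⧸ A)).lowerCentralSeries i = ⊥ := by
  rw [top_lowerCentralSeries_quotient, Subgroup.map_eq_bot_iff, QuotientGroup.ker_mk']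
  exact h

/-- Induction on the class: the last term `A` is central and finitely generated, and `G ⧸ A` has
smaller class, so `H` is an extension of finitely generated groups. -/
theorem Subgroup.fg_of_lowerCentralSeries_eq_bot (c : ℕ) : ∀ {G : Type*} [Group G] [Group.FG G],
    (⊤ : Subgroup G).lowerCentralSeries c = ⊥ → ∀ H : Subgroup G, H.FG := by
  induction c with
  | zero =>
    intro G _ _ h H
    rw [lowerCentralSeries_zero] at h
    rw [eq_bot_iff.mpr (h ▸ le_top : H ≤ ⊥)]
    exact Subgroup.FG.bot
  | succ c ih =>
    intro G _ hG h H
    let A := (⊤ : Subgroup G).lowerCentralSeries c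
    have hAc : A ≤ center G := commutator_top_right_eq_bot_iff_le_center.mp h
    have hQ := ih (top_lowerCentralSeries_quotient_eq_bot A c le_rfl)
    have hA : A.FG := by
      -- For `c = 0`, `A` is all of `G`. Otherwise `A = ⁅B, ⊤⁆`, and by induction `B` is finitely
      -- generated modulo the central subgroup `A`.
      rcases c with _ | d
      · exact Group.fg_def.mp hG
      · let B := (⊤ : Subgroup G).lowerCentralSeries d
        obtain ⟨T, hT⟩ := hQ (B.map (QuotientGroup.mk' A))
        have hTB : (T : Set (G ⧸ A)) ⊆ QuotientGroup.mk' A '' B := by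
          intro t ht
          have : t ∈ B.map (QuotientGroup.mk' A) := hT ▸ Subgroup.subset_closure ht
          exact this
        classical
        obtain ⟨S, hS, rfl⟩ := Finset.subset_set_image_iff.mp hTB
        refine commutator_top_fg_of_le_center hAc S.finite_toSet hS ?_
        intro b hb
        have h1 : QuotientGroup.mk' A b ∈ (closure (S : Set G)).map (QuotientGroup.mk' A) := by
          rw [MonoidHom.map_closure, ← Finset.coe_image, hT]
          exact mem_map_of_mem _ hb
        obtain ⟨s, hs, hsb⟩ := h1
        rw [← mul_inv_cancel_left s b]
        exact mul_mem (mem_sup_left hs)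
          (mem_sup_right (hAc (QuotientGroup.eq.mp hsb)))
    have : IsMulCommutative A := ⟨⟨fun a b => Subtype.ext (mem_center_iff.mp (hAc b.2) a)⟩⟩
    refine Subgroup.fg_of_fg_map_of_fg_inf_ker (QuotientGroup.mk' A) H (hQ _) ?_
    exact hA.of_le_of_isMulCommutative (by rw [QuotientGroup.ker_mk']; exact inf_le_right)

/-- Every subgroup of a finitely generated nilpotent group is finitely generated. -/
theorem Group.IsNilpotent.subgroup_fg {G : Type*} [Group G] [Group.FG G] [hG : Group.IsNilpotent G]
    (H : Subgroup G) : H.FG := by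
  obtain ⟨c, hc⟩ := Subgroup.nilpotent_iff_lowerCentralSeries.mp hG
  exact Subgroup.fg_of_lowerCentralSeries_eq_bot c hc H

/-- A finitely generated nilpotent group with finite center is finite. -/
theorem Group.IsNilpotent.finite_of_finite_center {G : Type*} [Group G] [hfg : Group.FG G]
    [hG : Group.IsNilpotent G] [hZ : Finite (center G)] : Finite G := by
  obtain ⟨X, hX, hXfin⟩ := Group.fg_iff.mp hfg
  have hXf : Finite X := hXfin
  have key : ∀ i, Finite (Subgroup.upperCentralSeries G i) := by
    intro i
    induction i with
    | zero => rw [Subgroup.upperCentralSeries_zero]; infer_instance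
    | succ i ih =>
      -- Commutators with the finitely many generators determine `z` up to the center, so the fibres
      -- of `f` are finite.
      let f : Subgroup.upperCentralSeries G (i + 1) → (X → Subgroup.upperCentralSeries G i) :=
        fun z x => ⟨⁅(z : G), (x : G)⁆, Subgroup.mem_upperCentralSeries_succ_iff.mp z.2 x⟩
      refine Set.finite_univ_iff.mp (Set.Finite.of_finite_fibers f (Set.toFinite _) ?_)
      rintro _ ⟨z, _, rfl⟩
      rw [Set.univ_inter]
      have hmem : ∀ w, f w = f z → (z : G)⁻¹ * w ∈ center G := by
        intro w hw
        have : (⊤ : Subgroup G) ≤ centralizer {(z : G)⁻¹ * w} := by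
          rw [← hX, closure_le]
          intro x hx
          have h1 := congrArg Subtype.val (congrFun hw ⟨x, hx⟩)
          simp only [f, commutatorElement_def, mul_left_inj] at h1
          rw [SetLike.mem_coe, mem_centralizer_singleton_iff]
          have h2 : (w : G) * x = z * x * (z : G)⁻¹ * w := by rw [← h1]; group
          rw [mul_assoc, h2]; group
        rw [mem_center_iff]
        intro g
        exact (mem_centralizer_singleton_iff.mp (this (mem_top g)))
      refine Finite.of_injective
        (fun w : f ⁻¹' {f z} => (⟨(z : G)⁻¹ * w.1, hmem w.1 w.2⟩ : center G)) ?_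
      intro w w' hww
      have := congrArg Subtype.val hww
      exact Subtype.ext (Subtype.ext (mul_left_cancel this))
  obtain ⟨i, hi⟩ := Group.IsNilpotent.nilpotent G
  have := key i
  rw [hi] at this
  exact Finite.of_equiv _ Subgroup.topEquiv.toEquiv

/-- A finite subgroup of a finitely generated nilpotent group is avoided by a normal subgroup of
finite index. -/
theorem Group.IsNilpotent.exists_finiteIndex_inf_eq_bot {G : Type*} [Group G] [Group.FG G]
    [Group.IsNilpotent G] (F : Subgroup G) [Finite F] :
    ∃ N : Subgroup G, N.Normal ∧ N.FiniteIndex ∧ N ⊓ F = ⊥ := by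
  -- A normal subgroup maximal among those avoiding `F` turns out to have finite index.
  let 𝒮 : Set (Subgroup G) := {N | N.Normal ∧ N ⊓ F = ⊥}
  obtain ⟨N, hN⟩ : ∃ N, Maximal (· ∈ 𝒮) N := by
    refine zorn_le₀ 𝒮 ?_
    intro C hC hchain
    by_cases hne : C.Nonempty
    · refine ⟨sSup C, ⟨?_, ?_⟩, fun s hs => le_sSup hs⟩
      · refine ⟨fun n hn g => ?_⟩
        obtain ⟨M, hM, hnM⟩ := (mem_sSup_of_directedOn hne hchain.directedOn).mp hn
        exact (mem_sSup_of_directedOn hne hchain.directedOn).mpr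
          ⟨M, hM, (hC hM).1.conj_mem n hnM g⟩
      · rw [eq_bot_iff]
        rintro x ⟨hx, hxF⟩
        obtain ⟨M, hM, hxM⟩ := (mem_sSup_of_directedOn hne hchain.directedOn).mp hx
        exact (hC hM).2.le ⟨hxM, hxF⟩
    · rw [Set.not_nonempty_iff_eq_empty] at hne
      exact ⟨⊥, ⟨inferInstance, bot_inf_eq F⟩, by simp [hne]⟩
  have hNn : N.Normal := hN.prop.1
  refine ⟨N, hNn, ?_, hN.prop.2⟩
  -- The preimage of a central infinite cyclic subgroup would still avoid `F`, whose elements are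
  -- torsion, against maximality.
  have htors : ∀ z ∈ center (G ⧸ N), IsOfFinOrder z := by
    intro z hz
    by_contra hinf
    obtain ⟨g, rfl⟩ := QuotientGroup.mk_surjective z
    have hZn : (zpowers (g : G ⧸ N)).Normal := by
      refine ⟨?_⟩
      rintro _ ⟨k, rfl⟩ x
      have hk : (g : G ⧸ N) ^ k ∈ center (G ⧸ N) := zpow_mem hz k
      have := mem_center_iff.mp hk x
      simp only
      rw [this, mul_inv_cancel_right]
      exact ⟨k, rfl⟩
    let M : Subgroup G := (zpowers (g : G ⧸ N)).comap (QuotientGroup.mk' N)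
    have hNM : N ≤ M := fun x hx => by
      have : QuotientGroup.mk' N x = 1 := (QuotientGroup.eq_one_iff x).mpr hx
      exact mem_comap.mpr (this ▸ one_mem _)
    have hMF : M ⊓ F = ⊥ := by
      rw [eq_bot_iff]
      rintro x ⟨⟨k, hk⟩, hxF⟩
      have hfin : IsOfFinOrder x :=
        MonoidHom.isOfFinOrder F.subtype (isOfFinOrder_of_finite (⟨x, hxF⟩ : F))
      have hfin' : IsOfFinOrder ((g : G ⧸ N) ^ k) := by
        simp only at hk
        rw [hk]
        exact MonoidHom.isOfFinOrder (QuotientGroup.mk' N) hfin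
      have hk0 : k = 0 := by
        by_contra hk0
        obtain ⟨l, hl, hkl⟩ := isOfFinOrder_iff_zpow_eq_one.mp hfin'
        exact hinf (isOfFinOrder_iff_zpow_eq_one.mpr
          ⟨k * l, mul_ne_zero hk0 hl, by rw [zpow_mul, hkl]⟩)
      subst hk0
      have : x ∈ N := (QuotientGroup.eq_one_iff x).mp (by simpa using hk.symm)
      exact hN.prop.2.le ⟨this, hxF⟩
    have hMN : M ≤ N := hN.le_of_ge ⟨hZn.comap _, hMF⟩ hNM
    have hg : g ∈ N := hMN (mem_zpowers _)
    apply hinf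
    rw [(QuotientGroup.eq_one_iff g).mpr hg]
    exact IsOfFinOrder.one
  have hZ : Finite (center (G ⧸ N)) := by
    have hfg : Group.FG (center (G ⧸ N)) :=
      (Group.fg_iff_subgroup_fg _).mpr (Group.IsNilpotent.subgroup_fg _)
    refine CommGroup.finite_of_fg_isMulTorsion _ fun z => ?_
    exact (Submonoid.isOfFinOrder_coe).mp (htors z z.2)
  have := Group.IsNilpotent.finite_of_finite_center (G := G ⧸ N)
  exact Subgroup.finiteIndex_of_finite_quotient

/-- The profinite topology of a finitely generated nilpotent group induces the full profinite
topology on a central subgroup. -/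
theorem Group.IsNilpotent.exists_finiteIndex_inf_subset_pow {G : Type*} [Group G] [Group.FG G]
    [Group.IsNilpotent G] (A : Subgroup G) (hA : A ≤ center G) (m : ℕ) (hm : m ≠ 0) :
    ∃ N : Subgroup G, N.Normal ∧ N.FiniteIndex ∧ ∀ x ∈ N, x ∈ A → ∃ a ∈ A, a ^ m = x := by
  have hcomm : IsMulCommutative A := ⟨⟨fun a b => Subtype.ext (mem_center_iff.mp (hA b.2) a)⟩⟩
  let B : Subgroup G := (powMonoidHom m : A →* A).range.map A.subtype
  have hB : ∀ x, x ∈ B ↔ ∃ a ∈ A, a ^ m = x := by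
    intro x
    constructor
    · rintro ⟨_, ⟨a, rfl⟩, rfl⟩
      exact ⟨a, a.2, rfl⟩
    · rintro ⟨a, ha, rfl⟩
      exact ⟨_, ⟨⟨a, ha⟩, rfl⟩, rfl⟩
  have hBc : B ≤ center G := by
    intro x hx
    obtain ⟨a, ha, rfl⟩ := (hB x).mp hx
    exact pow_mem (hA ha) m
  have hBn : B.Normal := ⟨fun b hb g => by
    rw [mem_center_iff.mp (hBc hb) g, mul_inv_cancel_right]; exact hb⟩
  -- `B` is the group of `m`-th powers of `A`. The image of `A` in `G ⧸ B` is finitely generated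
  -- abelian of exponent dividing `m`, hence finite; avoiding it forces elements of `A` into `B`.
  let F : Subgroup (G ⧸ B) := A.map (QuotientGroup.mk' B)
  have hF : Finite F := by
    have hFfg : Group.FG F := (Group.fg_iff_subgroup_fg _).mpr (Group.IsNilpotent.subgroup_fg _)
    refine CommGroup.finite_of_fg_isMulTorsion F fun z => ?_
    obtain ⟨_, a, ha, rfl⟩ := z
    rw [isOfFinOrder_iff_pow_eq_one]
    refine ⟨m, Nat.pos_of_ne_zero hm, Subtype.ext ?_⟩
    exact (QuotientGroup.eq_one_iff (a ^ m)).mpr ((hB _).mpr ⟨a, ha, rfl⟩)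
  obtain ⟨N, hNn, hNf, hNF⟩ := Group.IsNilpotent.exists_finiteIndex_inf_eq_bot F
  refine ⟨N.comap (QuotientGroup.mk' B), hNn.comap _, ?_, ?_⟩
  · exact (FiniteIndexNormalSubgroup.comap (QuotientGroup.mk' B) (.ofSubgroup N)).isFiniteIndex'
  intro x hx hxA
  have : QuotientGroup.mk' B x ∈ N ⊓ F := ⟨hx, mem_map_of_mem _ hxA⟩
  rw [hNF, mem_bot] at this
  exact (hB x).mp ((QuotientGroup.eq_one_iff x).mp this)

end FinitelyGeneratedNilpotent

/-! ### Endomorphisms that are trivial on the abelianization. -/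

section TrivialOnAbelianization

open Subgroup

open scoped commutatorElement

/-- An element whose commutators are all central commutes with the commutator subgroup. -/
theorem commute_of_mem_commutator {G : Type*} [Group G] {a : G} (ha : ∀ g, ⁅a, g⁆ ∈ center G)
    {v : G} (hv : v ∈ _root_.commutator G) : Commute a v := by
  rw [← commutatorElement_eq_one_iff_commute]
  rw [commutator_eq_closure] at hv
  have hmul : ∀ x y, ⁅a, x * y⁆ = ⁅a, x⁆ * ⁅a, y⁆ := fun x y =>
    commutatorElement_mul_right_of_mem_center x (ha y)
  -- Centrality makes g ↦ ⁅a, g⁆ a homomorphism to an abelian group, so it kills commutators.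
  let f : G →* center G := MonoidHom.mk' (fun g => ⟨⁅a, g⁆, ha g⟩) fun x y => Subtype.ext (hmul x y)
  have hf : closure (commutatorSet G) ≤ f.ker := by
    rw [closure_le]
    rintro _ ⟨x, y, rfl⟩
    rw [SetLike.mem_coe, MonoidHom.mem_ker, map_commutatorElement,
      commutatorElement_eq_one_iff_mul_comm]
    exact Subtype.ext (mem_center_iff.mp (f y).2 (f x))
  exact congrArg Subtype.val (hf hv)

/-- An endomorphism that is trivial on the abelianization is trivial on the quotients of the lower
central series. -/
theorem MonoidHom.inv_mul_apply_mem_lowerCentralSeries {G : Type*} [Group G] (f : G →* G)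
    (hf : ∀ g, g⁻¹ * f g ∈ _root_.commutator G) (i : ℕ) :
    ∀ a ∈ (⊤ : Subgroup G).lowerCentralSeries i,
      a⁻¹ * f a ∈ (⊤ : Subgroup G).lowerCentralSeries (i + 1) := by
  induction i with
  | zero => exact fun a _ => hf a
  | succ i ih =>
    let M := (⊤ : Subgroup G).lowerCentralSeries (i + 2)
    let π := QuotientGroup.mk' M
    have hcen : ∀ u ∈ (⊤ : Subgroup G).lowerCentralSeries (i + 1), π u ∈ center (G ⧸ M) := by
      intro u hu
      rw [mem_center_iff]
      intro y
      obtain ⟨g, rfl⟩ := QuotientGroup.mk'_surjective M y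
      refine (commutatorElement_eq_one_iff_mul_comm.mp ?_).symm
      rw [← map_commutatorElement]
      exact (QuotientGroup.eq_one_iff _).mpr (commutator_mem_commutator hu (mem_top g))
    -- It is enough to compare `f` with the identity modulo `M` on generators ⁅a, g⁆. Write f a = a
    -- u and f g = g v: modulo `M`, u is central and v commutes with a, so ⁅a u, g v⁆ = ⁅a, g⁆.
    suffices h : (⊤ : Subgroup G).lowerCentralSeries (i + 1) ≤ (π.comp f).eqLocus π by
      intro a ha
      exact QuotientGroup.eq.mp (h ha).symm
    rw [Subgroup.lowerCentralSeries_succ, commutator_le]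
    intro a ha g _
    have hu : π (a⁻¹ * f a) ∈ center (G ⧸ M) := hcen _ (ih a ha)
    have hac : ∀ y, ⁅π a, y⁆ ∈ center (G ⧸ M) := by
      intro y
      obtain ⟨g, rfl⟩ := QuotientGroup.mk'_surjective M y
      rw [← map_commutatorElement]
      exact hcen _ (commutator_mem_commutator ha (mem_top g))
    have hv : π (g⁻¹ * f g) ∈ _root_.commutator (G ⧸ M) := by
      have := mem_map_of_mem π (hf g)
      rw [map_commutator_eq] at this
      exact commutator_mono le_top le_top this
    have hav : ⁅π a, π (g⁻¹ * f g)⁆ = 1 := (commute_of_mem_commutator hac hv).commutator_eq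
    have hug : ⁅π (a⁻¹ * f a), π (f g)⁆ = 1 :=
      commutatorElement_eq_one_iff_mul_comm.mpr (mem_center_iff.mp hu _).symm
    change π (f ⁅a, g⁆) = π ⁅a, g⁆
    rw [map_commutatorElement, map_commutatorElement, map_commutatorElement]
    calc ⁅π (f a), π (f g)⁆ = ⁅π a * π (a⁻¹ * f a), π (f g)⁆ := by simp
      _ = ⁅π a, π (f g)⁆ := by
        rw [commutatorElement_mul_left_of_mem_center _ (by rw [hug]; exact one_mem _), hug, one_mul]
      _ = ⁅π a, π g * π (g⁻¹ * f g)⁆ := by simp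
      _ = ⁅π a, π g⁆ := by rw [commutatorElement_mul_right_of_mem_center _ (hac _), hav, mul_one]

/-- An endomorphism of a nilpotent group that is trivial on the abelianization is bijective. -/
theorem MonoidHom.bijective_of_trivial_on_abelianization {G : Type*} [Group G]
    [hG : Group.IsNilpotent G] (f : G →* G) (hf : ∀ g, g⁻¹ * f g ∈ _root_.commutator G) :
    Function.Bijective f := by
  obtain ⟨c, hc⟩ := Subgroup.nilpotent_iff_lowerCentralSeries.mp hG
  have key := f.inv_mul_apply_mem_lowerCentralSeries hf
  constructor
  · rw [injective_iff_map_eq_one]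
    intro a ha
    have : ∀ i, a ∈ (⊤ : Subgroup G).lowerCentralSeries i := by
      intro i
      induction i with
      | zero => exact mem_top a
      | succ i ih => simpa [ha] using key i a ih
    have := this c
    rwa [hc, mem_bot] at this
  -- Climb from the trivial term: a = f a · (a⁻¹ f a)⁻¹, and the second factor comes from the next
  -- term.
  · have : ∀ j i, i + j = c → (⊤ : Subgroup G).lowerCentralSeries i ≤ f.range := by
      intro j
      induction j with
      | zero =>
        rintro i rfl
        rw [add_zero] at hc
        rw [hc]
        exact bot_le
      | succ j ih =>
        intro i hi a ha
        have h1 := ih (i + 1) (by omega) (key i a ha)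
        have h2 := mul_mem (⟨a, rfl⟩ : f a ∈ f.range) (inv_mem h1)
        simpa using h2
    rw [← MonoidHom.range_eq_top, eq_top_iff]
    exact this c 0 (zero_add c)

end TrivialOnAbelianization

namespace NilpotentCSP

open Subgroup

open scoped commutatorElement

theorem mem_IA_iff {G : Type*} [Group G] {a : MulAut G} :
    a ∈ IA G ↔ ∀ g, g⁻¹ * a g ∈ commutator G := by
  have h : ∀ g, Abelianization.of (a g) = Abelianization.of g ↔ g⁻¹ * a g ∈ commutator G :=
    fun g => eq_comm.trans QuotientGroup.eq
  exact forall_congr' h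

/-! ### The free nilpotent group and its universal property. -/

section FreeNilpotent

variable {n c : ℕ}

/-- The standard generators of the free nilpotent group. -/
def FreeNilpotent.gen (n c : ℕ) (i : Fin n) : FreeNilpotent n c :=
  QuotientGroup.mk (FreeGroup.of i)

theorem FreeNilpotent.lowerCentralSeries_eq_bot (n c : ℕ) :
    (⊤ : Subgroup (FreeNilpotent n c)).lowerCentralSeries c = ⊥ :=
  top_lowerCentralSeries_quotient_eq_bot _ c le_rfl

instance FreeNilpotent.isNilpotent (n c : ℕ) : Group.IsNilpotent (FreeNilpotent n c) :=
  Subgroup.nilpotent_iff_lowerCentralSeries.mpr ⟨c, lowerCentralSeries_eq_bot n c⟩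

theorem FreeNilpotent.hom_ext {G : Type*} [Group G] {f g : FreeNilpotent n c →* G}
    (h : ∀ i, f (gen n c i) = g (gen n c i)) : f = g := by
  apply QuotientGroup.monoidHom_ext
  ext i
  exact h i

theorem FreeNilpotent.exists_hom {G : Type*} [Group G]
    (hG : (⊤ : Subgroup G).lowerCentralSeries c = ⊥) (v : Fin n → G) :
    ∃ f : FreeNilpotent n c →* G, ∀ i, f (gen n c i) = v i := by
  refine ⟨QuotientGroup.lift _ (FreeGroup.lift v) ?_, fun i => ?_⟩
  · intro x hx
    have h1 := mem_map_of_mem (FreeGroup.lift v) hx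
    rw [map_lowerCentralSeries] at h1
    have h2 : FreeGroup.lift v x ∈ (⊤ : Subgroup G).lowerCentralSeries c :=
      lowerCentralSeries_mono c le_top h1
    rwa [hG, mem_bot] at h2
  · exact FreeGroup.lift_apply_of

/-- Moving the generators inside their classes modulo the commutator subgroup defines an element
of `IA`. -/
theorem FreeNilpotent.exists_mem_IA {v : Fin n → FreeNilpotent n c}
    (hv : ∀ i, v i ∈ commutator (FreeNilpotent n c)) :
    ∃ a : IA (FreeNilpotent n c), ∀ i, a.1 (gen n c i) = gen n c i * v i := by
  obtain ⟨f, hf⟩ := exists_hom (lowerCentralSeries_eq_bot n c) fun i => gen n c i * v i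
  have hab : Abelianization.of.comp f = Abelianization.of := by
    apply hom_ext
    intro i
    have : Abelianization.of (v i) = 1 := (QuotientGroup.eq_one_iff _).mpr (hv i)
    rw [MonoidHom.comp_apply, hf, map_mul, this, mul_one]
  have hbij := f.bijective_of_trivial_on_abelianization fun g =>
    QuotientGroup.eq.mp (DFunLike.congr_fun hab g).symm
  exact ⟨⟨MulEquiv.ofBijective f hbij, fun g => DFunLike.congr_fun hab g⟩, hf⟩

instance finite_hom {G : Type*} [Group G] [Finite G] : Finite (FreeNilpotent n c →* G) :=
  Finite.of_injective (fun f (i : Fin n) => f (FreeNilpotent.gen n c i)) fun _ _ h =>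
    FreeNilpotent.hom_ext fun i => congrFun h i

end FreeNilpotent

/-! ### Congruence subgroups and reduction of the class. -/

section CongruenceSubgroup

/-- The elements of `IA(G)` that act trivially on `G / N`. -/
def congruenceSubgroup {G : Type*} [Group G] (N : Subgroup G) [N.Normal] : Subgroup (IA G) where
  carrier := {a | ∀ g, (QuotientGroup.mk (a.1 g) : G ⧸ N) = QuotientGroup.mk g}
  one_mem' _ := rfl
  mul_mem' {a b} ha hb g := (ha (b.1 g)).trans (hb g)
  inv_mem' {a} ha g := by
    have h := ha (a.1⁻¹ g)
    rw [MulAut.apply_inv_self] at h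
    exact h.symm

theorem mem_congruenceSubgroup_iff {G : Type*} [Group G] {N : Subgroup G} [N.Normal] {a : IA G} :
    a ∈ congruenceSubgroup N ↔ ∀ g, g⁻¹ * a.1 g ∈ N :=
  forall_congr' fun _ => eq_comm.trans QuotientGroup.eq

/-- Cosets are separated by the induced homomorphisms to the finite group `FreeNilpotent n c ⧸ N`,
of which there are finitely many. -/
theorem finiteIndex_congruenceSubgroup {n c : ℕ} (N : Subgroup (FreeNilpotent n c)) [N.Normal]
    [N.FiniteIndex] : (congruenceSubgroup N).FiniteIndex := by
  -- The inverse matches left cosets: evaluating at `b.1 g` shows that `a⁻¹ * b` is trivial modulo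
  -- `N`.
  let F : IA (FreeNilpotent n c) → (FreeNilpotent n c →* FreeNilpotent n c ⧸ N) := fun a =>
    (QuotientGroup.mk' N).comp (a⁻¹).1.toMonoidHom
  have hF : ∀ a b, F a = F b → a⁻¹ * b ∈ congruenceSubgroup N := by
    intro a b h g
    have := DFunLike.congr_fun h (b.1 g)
    change (QuotientGroup.mk (a.1⁻¹ (b.1 g)) : FreeNilpotent n c ⧸ N) =
      QuotientGroup.mk (b.1⁻¹ (b.1 g)) at this
    rw [MulAut.inv_apply_self] at this
    exact this
  have : Finite (IA (FreeNilpotent n c) ⧸ congruenceSubgroup N) := by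
    refine Finite.of_injective
      (fun q : IA (FreeNilpotent n c) ⧸ congruenceSubgroup N => F q.out) fun q q' h => ?_
    rw [← Quotient.out_eq' q, ← Quotient.out_eq' q']
    exact QuotientGroup.eq.mpr (hF _ _ h)
  exact Subgroup.finiteIndex_of_finite_quotient

end CongruenceSubgroup

section Reduction

variable {G Q : Type*} [Group G] [Group Q]

theorem exists_IA_of_surjective (p : G →* Q) (hp : Function.Surjective p)
    (hker : p.ker.Characteristic) (a : IA G) : ∃ b : IA Q, ∀ g, b.1 (p g) = p (a.1 g) := by
  have hlift : ∀ a : MulAut G, ∃ f : Q →* Q, ∀ g, f (p g) = p (a g) := by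
    intro a
    refine ⟨p.liftOfSurjective hp ⟨p.comp a.toMonoidHom, ?_⟩, fun g => ?_⟩
    · intro x hx
      have : x ∈ p.ker.comap a.toMonoidHom := by rwa [hker.fixed a]
      exact this
    · exact MonoidHom.liftOfRightInverse_comp_apply p _ (Function.rightInverse_surjInv hp) _ g
  obtain ⟨f, hf⟩ := hlift a.1
  obtain ⟨f', hf'⟩ := hlift a.1⁻¹
  let b : MulAut Q := MonoidHom.toMulEquiv f f'
    (by ext q; obtain ⟨g, rfl⟩ := hp q; simp [hf, hf'])
    (by ext q; obtain ⟨g, rfl⟩ := hp q; simp [hf, hf'])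
  refine ⟨⟨b, ?_⟩, hf⟩
  rw [mem_IA_iff]
  intro q
  obtain ⟨g, rfl⟩ := hp q
  change (p g)⁻¹ * f (p g) ∈ _
  rw [hf, ← map_inv, ← map_mul]
  have := mem_map_of_mem p (mem_IA_iff.mp a.2 g)
  rw [map_commutator_eq] at this
  exact commutator_mono le_top le_top this

/-- The homomorphism `IA(G) → IA(Q)` induced by a surjection `G → Q` with characteristic kernel. -/
noncomputable def IA.map (p : G →* Q) (hp : Function.Surjective p) (hker : p.ker.Characteristic) :
    IA G →* IA Q :=
  MonoidHom.mk' (fun a => (exists_IA_of_surjective p hp hker a).choose) fun a b => by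
    have h := fun a => (exists_IA_of_surjective p hp hker a).choose_spec
    apply Subtype.ext
    apply MulEquiv.ext
    intro q
    obtain ⟨g, rfl⟩ := hp q
    rw [h]
    change _ = (exists_IA_of_surjective p hp hker a).choose.1
      ((exists_IA_of_surjective p hp hker b).choose.1 (p g))
    rw [h, h]
    rfl

theorem IA.map_apply (p : G →* Q) (hp : Function.Surjective p) (hker : p.ker.Characteristic)
    (a : IA G) (g : G) : (IA.map p hp hker a).1 (p g) = p (a.1 g) :=
  (exists_IA_of_surjective p hp hker a).choose_spec g

end Reduction

/-! ### The congruence subgroup property. -/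

section CongruenceSubgroupProperty

variable {n c : ℕ}

/-- The projection from the free nilpotent group of class `c + 1` to that of class `c`. -/
def FreeNilpotent.reduce (n c : ℕ) : FreeNilpotent n (c + 1) →* FreeNilpotent n c :=
  QuotientGroup.map _ _ (MonoidHom.id _) (Subgroup.lowerCentralSeries_antitone ⊤ c.le_succ)

theorem FreeNilpotent.reduce_gen (i : Fin n) : reduce n c (gen n (c + 1) i) = gen n c i := rfl

theorem FreeNilpotent.reduce_surjective : Function.Surjective (reduce n c) := by
  intro x
  obtain ⟨g, rfl⟩ := QuotientGroup.mk_surjective x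
  exact ⟨QuotientGroup.mk g, rfl⟩

theorem FreeNilpotent.ker_reduce :
    (reduce n c).ker = (⊤ : Subgroup (FreeNilpotent n (c + 1))).lowerCentralSeries c := by
  rw [top_lowerCentralSeries_quotient]
  ext x
  obtain ⟨g, rfl⟩ := QuotientGroup.mk_surjective x
  rw [MonoidHom.mem_ker]
  constructor
  · intro h
    exact ⟨g, (QuotientGroup.eq_one_iff g).mp h, rfl⟩
  · rintro ⟨y, hy, hyg⟩
    rw [← hyg]
    exact (QuotientGroup.eq_one_iff y).mpr hy

instance FreeNilpotent.characteristic_ker_reduce : (reduce n c).ker.Characteristic := by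
  rw [ker_reduce]
  infer_instance

variable (n c) in
/-- The reduction homomorphism between the groups `IA` of successive free nilpotent groups. -/
noncomputable def reduceIA : IA (FreeNilpotent n (c + 1)) →* IA (FreeNilpotent n c) :=
  IA.map (FreeNilpotent.reduce n c) FreeNilpotent.reduce_surjective inferInstance

theorem reduceIA_apply (a : IA (FreeNilpotent n (c + 1))) (g : FreeNilpotent n (c + 1)) :
    (reduceIA n c a).1 (FreeNilpotent.reduce n c g) = FreeNilpotent.reduce n c (a.1 g) :=
  IA.map_apply _ _ _ a g

theorem IA_ext {a b : IA (FreeNilpotent n c)}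
    (h : ∀ i, a.1 (FreeNilpotent.gen n c i) = b.1 (FreeNilpotent.gen n c i)) : a = b := by
  have : a.1.toMonoidHom = b.1.toMonoidHom := FreeNilpotent.hom_ext h
  exact Subtype.ext (MulEquiv.ext fun g => DFunLike.congr_fun this g)

/-- The displacements of the generators lift to the commutator subgroup, and any lift defines an
element of `IA`. -/
theorem reduceIA_surjective : Function.Surjective (reduceIA n c) := by
  intro b
  have hv : ∀ i, ∃ v ∈ commutator (FreeNilpotent n (c + 1)), FreeNilpotent.reduce n c v =
      (FreeNilpotent.gen n c i)⁻¹ * b.1 (FreeNilpotent.gen n c i) := by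
    intro i
    have h := mem_IA_iff.mp b.2 (FreeNilpotent.gen n c i)
    rw [commutator_def, ← map_top_of_surjective _ (FreeNilpotent.reduce_surjective (c := c)),
      ← map_commutator] at h
    exact h
  choose v hv hvb using hv
  obtain ⟨a, ha⟩ := FreeNilpotent.exists_mem_IA hv
  refine ⟨a, IA_ext fun i => ?_⟩
  rw [← FreeNilpotent.reduce_gen, reduceIA_apply, ha, map_mul, hvb, FreeNilpotent.reduce_gen,
    mul_inv_cancel_left]

/-- Every finite index subgroup of `IA` of a free nilpotent group contains a congruence
subgroup. -/
theorem exists_congruenceSubgroup_le (n c : ℕ) : ∀ H : Subgroup (IA (FreeNilpotent n c)),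
    H.FiniteIndex → ∃ (N : Subgroup (FreeNilpotent n c)) (_ : N.Normal),
      N.FiniteIndex ∧ congruenceSubgroup N ≤ H := by
  have base : ∀ c, commutator (FreeNilpotent n c) = ⊥ → ∀ H : Subgroup (IA (FreeNilpotent n c)),
      ∃ (N : Subgroup (FreeNilpotent n c)) (_ : N.Normal),
        N.FiniteIndex ∧ congruenceSubgroup N ≤ H := by
    intro c hc H
    refine ⟨⊤, inferInstance, inferInstance, fun a _ => ?_⟩
    have : a = 1 := IA_ext fun i => by
      have h := mem_IA_iff.mp a.2 (FreeNilpotent.gen n c i)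
      rw [hc, mem_bot, inv_mul_eq_one] at h
      exact h.symm
    rw [this]
    exact one_mem H
  induction c with
  | zero =>
    refine fun H _ => base 0 ?_ H
    have h := FreeNilpotent.lowerCentralSeries_eq_bot n 0
    rw [eq_bot_iff, ← h]
    exact le_top
  | succ c ih =>
    -- Class 1 is separate because the last term lies in the commutator subgroup only from class 2
    -- on.
    rcases c with _ | c
    · exact fun H _ => base 1 (FreeNilpotent.lowerCentralSeries_eq_bot n 1) H
    intro H hH
    let A := (⊤ : Subgroup (FreeNilpotent n (c + 2))).lowerCentralSeries (c + 1)
    have hAc : A ≤ center _ := commutator_top_right_eq_bot_iff_le_center.mp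
      (FreeNilpotent.lowerCentralSeries_eq_bot n (c + 2))
    have hA1 : A ≤ commutator _ := Subgroup.lowerCentralSeries_antitone ⊤ (Nat.le_add_left 1 c)
    obtain ⟨N₂, hN₂n, hN₂f, hN₂⟩ := Group.IsNilpotent.exists_finiteIndex_inf_subset_pow A hAc
      H.normalCore.index FiniteIndex.index_ne_zero
    have hΓ := finiteIndex_congruenceSubgroup N₂
    -- Intersecting with `congruenceSubgroup N₂` keeps the correction `h` chosen below trivial
    -- modulo `N₂`, so that `k = h⁻¹ * a` is too.
    let H' := H.normalCore ⊓ congruenceSubgroup N₂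
    have hH' : (H'.map (reduceIA n (c + 1))).FiniteIndex :=
      ⟨ne_zero_of_dvd_ne_zero FiniteIndex.index_ne_zero
        (H'.index_map_dvd reduceIA_surjective)⟩
    obtain ⟨N₁, hN₁n, hN₁f, hN₁⟩ := ih _ hH'
    let N := N₁.comap (FreeNilpotent.reduce n (c + 1)) ⊓ N₂
    have hcomap : (N₁.comap (FreeNilpotent.reduce n (c + 1))).FiniteIndex :=
      (FiniteIndexNormalSubgroup.comap (FreeNilpotent.reduce n (c + 1))
        (.ofSubgroup N₁)).isFiniteIndex'
    refine ⟨N, inferInstance, inferInstance, fun a ha => ?_⟩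
    rw [mem_congruenceSubgroup_iff] at ha
    have ha₁ : reduceIA n (c + 1) a ∈ congruenceSubgroup N₁ := by
      rw [mem_congruenceSubgroup_iff]
      intro q
      obtain ⟨g, rfl⟩ := FreeNilpotent.reduce_surjective q
      rw [reduceIA_apply, ← map_inv, ← map_mul]
      exact (ha g).1
    obtain ⟨h, hh, hha⟩ := hN₁ ha₁
    let k := h⁻¹ * a
    have hk₂ : k ∈ congruenceSubgroup N₂ := mul_mem (inv_mem hh.2)
      (mem_congruenceSubgroup_iff.mpr fun g => (ha g).2)
    have hkA : ∀ g, g⁻¹ * k.1 g ∈ A := by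
      intro g
      have hk1 : reduceIA n (c + 1) k = 1 := by simp [k, hha]
      have h1 := reduceIA_apply k g
      rw [hk1] at h1
      have h2 : g⁻¹ * k.1 g ∈ (FreeNilpotent.reduce n (c + 1)).ker := by
        rw [MonoidHom.mem_ker, map_mul, map_inv, ← h1]
        exact inv_mul_cancel _
      rwa [FreeNilpotent.ker_reduce] at h2
    choose v hvA hv using fun i => hN₂ _ (mem_congruenceSubgroup_iff.mp hk₂
      (FreeNilpotent.gen n (c + 2) i)) (hkA _)
    obtain ⟨b, hb⟩ := FreeNilpotent.exists_mem_IA fun i => hA1 (hvA i)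
    -- `b` moves `A` only by elements of the next term, which is trivial; hence powers of `b` act on
    -- generators by powers of `v i`.
    have hbv : ∀ x ∈ A, b.1 x = x := by
      intro x hx
      have := b.1.toMonoidHom.inv_mul_apply_mem_lowerCentralSeries (mem_IA_iff.mp b.2) (c + 1) x hx
      rw [FreeNilpotent.lowerCentralSeries_eq_bot n (c + 2), mem_bot, inv_mul_eq_one] at this
      exact this.symm
    have hbpow : ∀ (m : ℕ) (i : Fin n), (b ^ m).1 (FreeNilpotent.gen n (c + 2) i) =
        FreeNilpotent.gen n (c + 2) i * v i ^ m := by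
      intro m i
      induction m with
      | zero => simp
      | succ m ihm =>
        rw [pow_succ']
        change b.1 ((b ^ m).1 _) = _
        rw [ihm, map_mul, hb, hbv _ (pow_mem (hvA i) m), mul_assoc, pow_succ']
    have hkb : k = b ^ H.normalCore.index := IA_ext fun i => by
      rw [hbpow, hv, mul_inv_cancel_left]
    have hkH : k ∈ H.normalCore := hkb ▸ H.normalCore.pow_index_mem b
    have : a = h * k := by simp [k]
    rw [this]
    exact H.normalCore_le (mul_mem hh.1 hkH)

end CongruenceSubgroupProperty

end NilpotentCSP

namespace NilpotentCSP

universe u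

/-! ### Topology of the group of continuous automorphisms. -/

section ContinuousAutomorphisms

variable {P : Type u} [Group P] [TopologicalSpace P]

/-- Continuous homomorphisms that agree on topological generators are equal. -/
theorem eq_of_eqOn_topologicalGenerators {Q ι : Type*} [Group Q] [TopologicalSpace Q] [T2Space Q]
    {x : ι → P} (hx : Dense (Subgroup.closure (Set.range x) : Set P)) {f g : P →* Q}
    (hf : Continuous f) (hg : Continuous g) (h : ∀ i, f (x i) = g (x i)) : f = g := by
  have hle : Subgroup.closure (Set.range x) ≤ f.eqLocus g := by
    rw [Subgroup.closure_le]
    rintro _ ⟨i, rfl⟩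
    exact h i
  exact DFunLike.coe_injective (Continuous.ext_on hx hf hg fun y hy => hle hy)

theorem continuous_contAut_toContinuousMap :
    Continuous fun a : P ≃ₜ* P => (⟨a, a.continuous_toFun⟩ : C(P, P)) :=
  continuous_induced_dom

theorem continuous_contAut_apply (p : P) : Continuous fun a : P ≃ₜ* P => a p :=
  (continuous_eval_const (F := C(P, P)) p).comp continuous_contAut_toContinuousMap

instance [T2Space P] : T2Space (P ≃ₜ* P) :=
  T2Space.of_injective_continuous (f := fun (a : P ≃ₜ* P) (p : P) => a p)
    (fun _ _ h => ContinuousMulEquiv.ext fun p => congrFun h p)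
    (continuous_pi continuous_contAut_apply)

instance [TotallyDisconnectedSpace P] : TotallyDisconnectedSpace (P ≃ₜ* P) :=
  ⟨isTotallyDisconnected_of_image (f := fun (a : P ≃ₜ* P) (p : P) => a p)
    (continuous_pi continuous_contAut_apply).continuousOn
    (fun _ _ h => ContinuousMulEquiv.ext fun p => congrFun h p)
    (isTotallyDisconnected_of_totallyDisconnectedSpace _)⟩

theorem continuousMul_contAut [LocallyCompactSpace P] : ContinuousMul (P ≃ₜ* P) where
  continuous_mul := continuous_induced_rng.mpr <|
    (continuous_contAut_toContinuousMap.comp continuous_fst).compCM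
      (continuous_contAut_toContinuousMap.comp continuous_snd)

end ContinuousAutomorphisms

/-! ### Compactness of `contIA P` for topologically finitely generated profinite `P`. -/

section Endomorphisms

variable {P : Type u} [Group P] [TopologicalSpace P] 

/-- The intersection of the kernels of all continuous homomorphisms to `P / U`. -/
def homKernel (U : OpenNormalSubgroup P) : Subgroup P :=
  ⨅ f : {f : P →* P ⧸ U.toSubgroup // Continuous f}, f.1.ker

/-- Topological finite generation leaves only finitely many continuous homomorphisms to the finite
group `P ⧸ U`. -/
theorem isOpen_homKernel [IsTopologicalGroup P] [CompactSpace P] {ι : Type*} [Finite ι] {x : ι → P}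
    (hx : Dense (Subgroup.closure (Set.range x) : Set P)) (U : OpenNormalSubgroup P) :
    IsOpen (homKernel U : Set P) := by
  have hdisc : DiscreteTopology (P ⧸ U.toSubgroup) := QuotientGroup.discreteTopology U.isOpen'
  have hfin : Finite (P ⧸ U.toSubgroup) := finite_of_compact_of_discrete
  have : Finite {f : P →* P ⧸ U.toSubgroup // Continuous f} :=
    Finite.of_injective (fun f (i : ι) => f.1 (x i)) fun f g h =>
      Subtype.ext (eq_of_eqOn_topologicalGenerators hx f.2 g.2 fun i => congrFun h i)
  rw [homKernel, Subgroup.coe_iInf]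
  refine isOpen_iInter_of_finite fun f => ?_
  exact (isOpen_discrete {1}).preimage f.2

theorem apply_mem_of_mem_homKernel {U : OpenNormalSubgroup P} {f : P →* P} (hf : Continuous f)
    {p : P} (hp : p ∈ homKernel U) : f p ∈ U := by
  have := Subgroup.mem_iInf.mp hp
    ⟨(QuotientGroup.mk' U.toSubgroup).comp f, continuous_quotient_mk'.comp hf⟩
  exact (QuotientGroup.eq_one_iff (f p)).mp this

variable (P) in
/-- The endomorphisms that map each `homKernel U` into `U`, with the topology of pointwise
convergence. For a topologically finitely generated profinite group, these are the continuous
endomorphisms. -/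
def equicontEnd : Set (P → P) :=
  {f | (∀ a b, f (a * b) = f a * f b) ∧ ∀ U : OpenNormalSubgroup P, ∀ p ∈ homKernel U, f p ∈ U}

theorem isClosed_equicontEnd [IsTopologicalGroup P] [T2Space P] : IsClosed (equicontEnd P) := by
  simp only [equicontEnd, Set.ofPred_and, Set.ofPred_forall]
  refine IsClosed.inter ?_ ?_
  · refine isClosed_iInter fun a => isClosed_iInter fun b => isClosed_eq ?_ ?_ <;> fun_prop
  · refine isClosed_iInter fun U => isClosed_iInter fun p => isClosed_iInter fun _ => ?_
    exact (U.toOpenSubgroup.isClosed).preimage (continuous_apply p)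

/-- The neighbourhood `homKernel U` serves all endomorphisms at once. This equicontinuity upgrades
pointwise convergence to joint continuity, through f(p) = f₀(p₀) · (f₀(p₀)⁻¹ f(p₀)) · f(p₀⁻¹ p). -/
theorem continuous_equicontEnd_eval [IsTopologicalGroup P] [CompactSpace P]
    [TotallyDisconnectedSpace P] {ι : Type*} [Finite ι] {x : ι → P}
    (hx : Dense (Subgroup.closure (Set.range x) : Set P)) :
    Continuous fun q : equicontEnd P × P => q.1.1 q.2 := by
  rw [continuous_iff_continuousAt]
  rintro ⟨f₀, p₀⟩
  intro W hW
  rw [Filter.mem_map]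
  obtain ⟨V, hVW, hVo, hV⟩ := mem_nhds_iff.mp hW
  obtain ⟨U, hU⟩ := ProfiniteGrp.exist_openNormalSubgroup_sub_open_nhds_of_one
    (U := (fun y => f₀.1 p₀ * y) ⁻¹' V) (hVo.preimage (continuous_const_mul _))
    (by simpa using hV)
  have h1 : {f : equicontEnd P | (f₀.1 p₀)⁻¹ * f.1 p₀ ∈ U} ∈ nhds f₀ := by
    refine IsOpen.mem_nhds (U.isOpen'.preimage ?_) ?_
    · exact continuous_const.mul ((continuous_apply p₀).comp continuous_subtype_val)
    · change (f₀.1 p₀)⁻¹ * f₀.1 p₀ ∈ U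
      rw [inv_mul_cancel]
      exact one_mem U
  have h2 : {p : P | p₀⁻¹ * p ∈ homKernel U} ∈ nhds p₀ := by
    refine IsOpen.mem_nhds ((isOpen_homKernel hx U).preimage (continuous_const_mul _)) ?_
    change p₀⁻¹ * p₀ ∈ homKernel U
    rw [inv_mul_cancel]
    exact one_mem _
  filter_upwards [prod_mem_nhds h1 h2] with q hq
  apply hVW
  have h3 := hU (mul_mem hq.1 (q.1.2.2 U _ hq.2))
  change f₀.1 p₀ * ((f₀.1 p₀)⁻¹ * q.1.1 p₀ * q.1.1 (p₀⁻¹ * q.2)) ∈ V at h3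
  rw [← mul_assoc, mul_inv_cancel_left, ← q.1.2.1, mul_inv_cancel_left] at h3
  exact h3

variable (P) in
/-- Pairs of mutually inverse endomorphisms that are trivial on the topological abelianization. -/
def inversePairs [IsTopologicalGroup P] : Set (equicontEnd P × equicontEnd P) :=
  {q | (∀ p, q.1.1 (q.2.1 p) = p) ∧ (∀ p, q.2.1 (q.1.1 p) = p) ∧
    ∀ p, p⁻¹ * q.1.1 p ∈ (commutator P).topologicalClosure}

theorem mem_contIA_iff [IsTopologicalGroup P] {a : P ≃ₜ* P} :
    a ∈ contIA P ↔ ∀ p, p⁻¹ * a p ∈ (commutator P).topologicalClosure :=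
  forall_congr' fun _ => eq_comm.trans QuotientGroup.eq

/-- Recording the inverse alongside each automorphism makes invertibility a closed condition in a
compact space of pairs, and turns inversion into a swap of coordinates. -/
theorem compactSpace_and_isTopologicalGroup_contIA [IsTopologicalGroup P] [CompactSpace P]
    [T2Space P] [TotallyDisconnectedSpace P] {ι : Type*} [Finite ι] {x : ι → P}
    (hx : Dense (Subgroup.closure (Set.range x) : Set P)) :
    CompactSpace (contIA P) ∧ IsTopologicalGroup (contIA P) := by
  have heval := continuous_equicontEnd_eval hx
  have hcont : ∀ f : equicontEnd P, Continuous f.1 := fun f =>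
    heval.comp (continuous_const.prodMk continuous_id)
  have hcE : CompactSpace (equicontEnd P) :=
    isCompact_iff_compactSpace.mp isClosed_equicontEnd.isCompact
  have hclosed : IsClosed (inversePairs P) := by
    simp only [inversePairs, Set.ofPred_and, Set.ofPred_forall]
    refine IsClosed.inter ?_ (IsClosed.inter ?_ ?_)
    · refine isClosed_iInter fun p => isClosed_eq ?_ continuous_const
      exact heval.comp (continuous_fst.prodMk
        (heval.comp (continuous_snd.prodMk continuous_const)))
    · refine isClosed_iInter fun p => isClosed_eq ?_ continuous_const
      exact heval.comp (continuous_snd.prodMk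
        (heval.comp (continuous_fst.prodMk continuous_const)))
    · refine isClosed_iInter fun p => ?_
      exact (Subgroup.isClosed_topologicalClosure _).preimage
        (continuous_const.mul (heval.comp (continuous_fst.prodMk continuous_const)))
  have hcK : CompactSpace (inversePairs P) := isCompact_iff_compactSpace.mp hclosed.isCompact
  let F : inversePairs P → contIA P := fun q =>
    ⟨{ toFun := q.1.1.1
       invFun := q.1.2.1
       left_inv := q.2.2.1
       right_inv := q.2.1
       map_mul' := q.1.1.2.1
       continuous_toFun := hcont q.1.1
       continuous_invFun := hcont q.1.2 }, mem_contIA_iff.mpr q.2.2.2⟩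
  have hF : Continuous F := by
    refine Continuous.subtype_mk (continuous_induced_rng.mpr ?_) _
    -- Currying the jointly continuous evaluation gives continuity into the compact-open topology.
    let ev : C(equicontEnd P × P, P) := ⟨_, heval⟩
    exact ev.curry.continuous.comp (continuous_fst.comp continuous_subtype_val)
  have hmem : ∀ a : P ≃ₜ* P, ⇑a ∈ equicontEnd P := fun a =>
    ⟨map_mul a, fun U p hp =>
      apply_mem_of_mem_homKernel (f := a.toMulEquiv.toMonoidHom) a.continuous_toFun hp⟩
  have hsurj : Function.Surjective F := fun a =>
    ⟨⟨(⟨a.1, hmem a.1⟩, ⟨a.1.symm, hmem a.1.symm⟩), a.1.apply_symm_apply, a.1.symm_apply_apply,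
      mem_contIA_iff.mp a.2⟩, Subtype.ext (ContinuousMulEquiv.ext fun _ => rfl)⟩
  have hcompact : CompactSpace (contIA P) :=
    ⟨by rw [← hsurj.range_eq]; exact isCompact_range hF⟩
  refine ⟨hcompact, ?_⟩
  have := continuousMul_contAut (P := P)
  -- A continuous surjection from a compact space to a Hausdorff one is a quotient map, so
  -- continuity of inversion can be checked on pairs.
  have hquot : Topology.IsQuotientMap F := Topology.IsQuotientMap.of_surjective_continuous hsurj hF
  refine { continuous_mul := ?_, continuous_inv := ?_ }
  · exact Continuous.subtype_mk ((continuous_subtype_val.comp continuous_fst).mul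
      (continuous_subtype_val.comp continuous_snd)) _
  · rw [hquot.continuous_iff]
    have hswap : ∀ q : inversePairs P, (q.1.2, q.1.1) ∈ inversePairs P := fun q =>
      ⟨q.2.2.1, q.2.1, mem_contIA_iff.mp (F q)⁻¹.2⟩
    have : (fun a : contIA P => a⁻¹) ∘ F = F ∘ fun q => ⟨(q.1.2, q.1.1), hswap q⟩ := by
      funext q
      exact Subtype.ext (ContinuousMulEquiv.ext fun _ => rfl)
    rw [this]
    refine hF.comp (Continuous.subtype_mk ?_ _)
    exact (continuous_snd.comp continuous_subtype_val).prodMk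
      (continuous_fst.comp continuous_subtype_val)

end Endomorphisms

end NilpotentCSP

namespace NilpotentCSP

universe u

/-! ### Profinite completions and induced automorphisms. -/

section Completion

open scoped commutatorElement

variable {G H : Type u} [Group G] [Group H]

theorem denseRange_eta : DenseRange (eta G) :=
  ProfiniteGrp.ProfiniteCompletion.denseRange (GrpCat.of G)

theorem completionMap_eta (f : G →* H) (g : G) : completionMap f (eta G g) = eta H (f g) :=
  ConcreteCategory.congr_hom (ProfiniteGrp.ProfiniteCompletion.lift_eta
    (GrpCat.ofHom f ≫ ProfiniteGrp.ProfiniteCompletion.eta (GrpCat.of H))) g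

theorem completionAut_eta (a : MulAut G) (g : G) : completionAut a (eta G g) = eta G (a g) :=
  completionMap_eta _ g

theorem exists_extension_eta (P : Type u) [Group P] [TopologicalSpace P] [IsTopologicalGroup P]
    [CompactSpace P] [TotallyDisconnectedSpace P] (f : G →* P) :
    ∃ φ : Completion G →ₜ* P, ∀ g, φ (eta G g) = f g :=
  ⟨(ProfiniteGrp.ProfiniteCompletion.lift (P := ProfiniteGrp.of P) (GrpCat.ofHom f)).hom,
    fun g => ConcreteCategory.congr_hom (ProfiniteGrp.ProfiniteCompletion.lift_eta
      (P := ProfiniteGrp.of P) (GrpCat.ofHom f)) g⟩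

/-- A finite index normal subgroup is the preimage of an open set of the profinite completion. -/
theorem exists_isOpen_eta_mem_iff (N : Subgroup G) [N.Normal] [N.FiniteIndex] :
    ∃ V : Set (Completion G), IsOpen V ∧ ∀ g, eta G g ∈ V ↔ g ∈ N := by
  let _ : TopologicalSpace (G ⧸ N) := ⊥
  have : DiscreteTopology (G ⧸ N) := ⟨rfl⟩
  obtain ⟨q, hq⟩ := exists_extension_eta (G ⧸ N) (QuotientGroup.mk' N)
  refine ⟨q ⁻¹' {1}, (isOpen_discrete _).preimage q.continuous_toFun, fun g => ?_⟩
  rw [Set.mem_preimage, hq]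
  exact QuotientGroup.eq_one_iff g

/-- The commutator is continuous and `G` has dense image, so commutators of `Completion G` are
limits of commutators from `G`. -/
theorem topologicalClosure_commutator_completion_le :
    (commutator (Completion G)).topologicalClosure ≤
      ((commutator G).map (eta G)).topologicalClosure := by
  refine Subgroup.topologicalClosure_minimal _ ?_ (Subgroup.isClosed_topologicalClosure _)
  rw [commutator_def, Subgroup.commutator_le]
  intro p _ q _
  refine denseRange_eta.induction_on₂
    (p := fun p q : Completion G => ⁅p, q⁆ ∈ ((commutator G).map (eta G)).topologicalClosure)
    ?_ ?_ p q
  · refine (Subgroup.isClosed_topologicalClosure _).preimage ?_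
    simp only [commutatorElement_def]
    fun_prop
  · intro a b
    rw [← map_commutatorElement]
    exact Subgroup.le_topologicalClosure _ (Subgroup.mem_map_of_mem _
      (Subgroup.commutator_mem_commutator (Subgroup.mem_top a) (Subgroup.mem_top b)))

theorem completionAut_mem_contIA (a : IA G) : completionAut a.1 ∈ contIA (Completion G) := by
  rw [mem_contIA_iff]
  intro p
  refine denseRange_eta.induction_on
    (p := fun p => p⁻¹ * completionAut a.1 p ∈ (commutator (Completion G)).topologicalClosure) p
    ?_ ?_
  · exact (Subgroup.isClosed_topologicalClosure _).preimage
      (continuous_inv.mul (completionAut a.1).continuous_toFun)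
  · intro g
    rw [completionAut_eta, ← map_inv, ← map_mul]
    have h := Subgroup.mem_map_of_mem (eta G) (mem_IA_iff.mp a.2 g)
    rw [map_commutator_eq] at h
    exact Subgroup.le_topologicalClosure _ (Subgroup.commutator_mono le_top le_top h)

variable (G) in
/-- The homomorphism from `IA(G)` to `IA` of the profinite completion. -/
noncomputable def inducedIA : IA G →* contIA (Completion G) :=
  MonoidHom.mk' (fun a => ⟨completionAut a.1, completionAut_mem_contIA a⟩) fun a b => by
    refine Subtype.ext (ContinuousMulEquiv.ext fun p => ?_)
    refine congrFun (denseRange_eta.equalizer (completionAut (a * b).1).continuous_toFun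
      ((completionAut a.1).continuous_toFun.comp (completionAut b.1).continuous_toFun) ?_) p
    funext g
    change completionAut (a * b).1 (eta G g) = completionAut a.1 (completionAut b.1 (eta G g))
    rw [completionAut_eta, completionAut_eta, completionAut_eta]
    rfl

theorem IsCongruenceMap.unique {φ ψ : Completion (IA G) →ₜ* contIA (Completion G)}
    (hφ : IsCongruenceMap φ) (hψ : IsCongruenceMap ψ) : φ = ψ := by
  refine DFunLike.coe_injective
    (denseRange_eta.equalizer φ.continuous_toFun ψ.continuous_toFun ?_)
  funext a
  exact Subtype.ext ((hφ a).trans (hψ a).symm)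

end Completion

/-! ### The congruence map is bijective. -/

section Main

variable {n c : ℕ}

theorem dense_closure_range_eta_gen : Dense (Subgroup.closure (Set.range fun i =>
    eta (FreeNilpotent n c) (FreeNilpotent.gen n c i)) : Set (Completion (FreeNilpotent n c))) := by
  refine denseRange_eta.mono ?_
  rintro _ ⟨x, rfl⟩
  obtain ⟨g, rfl⟩ := QuotientGroup.mk'_surjective _ x
  have hg : g ∈ Subgroup.closure (Set.range (FreeGroup.of (α := Fin n))) := by
    rw [FreeGroup.closure_range_of]
    exact Subgroup.mem_top g
  have h := Subgroup.mem_map_of_mem ((eta (FreeNilpotent n c)).comp (QuotientGroup.mk' _)) hg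
  rw [MonoidHom.map_closure, ← Set.range_comp] at h
  exact h

theorem exists_isCongruenceMap (n c : ℕ) :
    ∃ φ : Completion (IA (FreeNilpotent n c)) →ₜ* contIA (Completion (FreeNilpotent n c)),
      IsCongruenceMap φ := by
  obtain ⟨_, _⟩ :=
    compactSpace_and_isTopologicalGroup_contIA (dense_closure_range_eta_gen (n := n) (c := c))
  obtain ⟨φ, hφ⟩ := exists_extension_eta _ (inducedIA (FreeNilpotent n c))
  exact ⟨φ, fun a => congrArg Subtype.val (hφ a)⟩

theorem IsCongruenceMap.injective
    {φ : Completion (IA (FreeNilpotent n c)) →ₜ* contIA (Completion (FreeNilpotent n c))}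
    (hφ : IsCongruenceMap φ) : Function.Injective φ := by
  rw [injective_iff_map_eq_one]
  intro x hx
  by_contra hx1
  obtain ⟨U, hU⟩ := ProfiniteGrp.exist_openNormalSubgroup_sub_open_nhds_of_one
    (U := {x}ᶜ) isOpen_compl_singleton (fun h => hx1 (Set.mem_singleton_iff.mp h).symm)
  have hH := (U.toFiniteIndexNormalSubgroup.comap (eta (IA (FreeNilpotent n c)))).isFiniteIndex'
  obtain ⟨N, _, _, hNH⟩ := exists_congruenceSubgroup_le n c _ hH
  obtain ⟨V, hVo, hV⟩ := exists_isOpen_eta_mem_iff N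
  let y := fun i => eta (FreeNilpotent n c) (FreeNilpotent.gen n c i)
  -- An `a` in `IA` whose image lies in `W` fixes the generators modulo `N`, so it lies in
  -- `congruenceSubgroup N`.
  let W : Set (contIA (Completion (FreeNilpotent n c))) := ⋂ i, {a | (y i)⁻¹ * a.1 (y i) ∈ V}
  have hWo : IsOpen W := by
    refine isOpen_iInter_of_finite fun i => hVo.preimage ?_
    exact continuous_const.mul ((continuous_contAut_apply (y i)).comp continuous_subtype_val)
  have hxW : φ x ∈ W := by
    rw [hx]
    refine Set.mem_iInter.mpr fun i => ?_
    change (y i)⁻¹ * y i ∈ V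
    rw [inv_mul_cancel, ← map_one (eta (FreeNilpotent n c)), hV]
    exact one_mem N
  -- Approximate `x` by `a` inside `x U`: the congruence subgroup property puts `a` in `U`, which
  -- would force `x` into `U`.
  obtain ⟨a, haW, haU⟩ := denseRange_eta.exists_mem_open
    ((hWo.preimage φ.continuous_toFun).inter (U.isOpen'.preimage (continuous_const_mul x⁻¹)))
    ⟨x, hxW, by
      change x⁻¹ * x ∈ U
      rw [inv_mul_cancel]
      exact one_mem U⟩
  have haN : a ∈ congruenceSubgroup N := by
    have hhom : (QuotientGroup.mk' N).comp a.1.toMonoidHom = QuotientGroup.mk' N := by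
      refine FreeNilpotent.hom_ext fun i => ?_
      have hi : (y i)⁻¹ * (φ (eta _ a)).1 (y i) ∈ V := Set.mem_iInter.mp haW i
      rw [hφ a, completionAut_eta, ← map_inv, ← map_mul, hV] at hi
      exact (QuotientGroup.eq.mpr hi).symm
    exact fun g => DFunLike.congr_fun hhom g
  have haU' : eta _ a ∈ U := hNH haN
  have hxU : x ∈ U := by
    have h : eta _ a * (x⁻¹ * eta _ a)⁻¹ ∈ U := mul_mem haU' (inv_mem haU)
    simpa using h
  exact hU hxU rfl

theorem IsCongruenceMap.surjective
    {φ : Completion (IA (FreeNilpotent n c)) →ₜ* contIA (Completion (FreeNilpotent n c))}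
    (hφ : IsCongruenceMap φ) : Function.Surjective φ := by
  intro a
  let y := fun i => eta (FreeNilpotent n c) (FreeNilpotent.gen n c i)
  let ev : contIA (Completion (FreeNilpotent n c)) → Fin n → Completion (FreeNilpotent n c) :=
    fun a i => (y i)⁻¹ * a.1 (y i)
  have hev : Continuous ev := continuous_pi fun i =>
    continuous_const.mul ((continuous_contAut_apply (y i)).comp continuous_subtype_val)
  have hclosed : IsClosed (Set.range (ev ∘ φ)) :=
    (isCompact_range (hev.comp φ.continuous_toFun)).isClosed
  let S : Set (Completion (FreeNilpotent n c)) :=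
    (commutator (FreeNilpotent n c)).map (eta (FreeNilpotent n c))
  -- Every tuple of displacements from the discrete commutator subgroup is attained on `IA`; the
  -- closed range then contains all limits of such tuples.
  have hS : Set.pi Set.univ (fun _ : Fin n => S) ⊆ Set.range (ev ∘ φ) := by
    intro s hs
    choose v hv hvs using fun i => hs i (Set.mem_univ i)
    obtain ⟨b, hb⟩ := FreeNilpotent.exists_mem_IA hv
    refine ⟨eta _ b, funext fun i => ?_⟩
    change (y i)⁻¹ * (φ (eta _ b)).1 (y i) = s i
    rw [hφ b, completionAut_eta, hb, map_mul, inv_mul_cancel_left, hvs]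
  have ha : ev a ∈ closure (Set.pi Set.univ (fun _ : Fin n => S)) := by
    rw [closure_pi_set]
    exact fun i _ => topologicalClosure_commutator_completion_le (mem_contIA_iff.mp a.2 (y i))
  obtain ⟨x, hx⟩ := closure_minimal hS hclosed ha
  refine ⟨x, Subtype.ext ?_⟩
  have h := eq_of_eqOn_topologicalGenerators dense_closure_range_eta_gen
    (f := (φ x).1.toMulEquiv.toMonoidHom) (g := a.1.toMulEquiv.toMonoidHom)
    (φ x).1.continuous_toFun a.1.continuous_toFun
    fun i => mul_left_cancel (congrFun hx i)
  exact ContinuousMulEquiv.ext fun p => DFunLike.congr_fun h p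

end Main

end NilpotentCSP

open NilpotentCSP in
theorem theorem4p1 (n c : ℕ) :
    (∃! φ : Completion (IA (FreeNilpotent n c)) →ₜ* contIA (Completion (FreeNilpotent n c)),
      IsCongruenceMap φ) ∧
    ∀ φ : Completion (IA (FreeNilpotent n c)) →ₜ* contIA (Completion (FreeNilpotent n c)),
      IsCongruenceMap φ →
        ∃ e : Completion (IA (FreeNilpotent n c)) ≃ₜ* contIA (Completion (FreeNilpotent n c)),
          ∀ x, e x = φ x := by
  refine ⟨?_, fun φ hφ => ?_⟩
  · obtain ⟨φ, hφ⟩ := exists_isCongruenceMap n c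
    exact ⟨φ, hφ, fun ψ hψ => hψ.unique hφ⟩
  · let e := MulEquiv.ofBijective φ ⟨hφ.injective, hφ.surjective⟩
    have he : Continuous e.toEquiv := φ.continuous_toFun
    exact ⟨{ e with
      continuous_toFun := he
      continuous_invFun := he.continuous_symm_of_equiv_compact_to_t2 }, fun _ => rfl⟩
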